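/- Let $p\in[1,\infty]$, with the convention $2^{1/p}=1$ for $p=\infty$. For a linear operator $A$ on $\mathbb{C}^d$ let $\|A\|_p$ be its Schatten $p$-norm, i.e. the $\ell^p$-norm of the vector of its singular values (with multiplicity). A measurement on $\mathbb{C}^d$ with $n$ outcomes is a family $E=\{E_a\}_{a=1}^n$ of non-zero positive semi-definite operators on $\mathbb{C}^d$ with $\sum_a E_a=\mathbb{1}$. For measurements $E=\{E_a\}_{a=1}^{n_E}$ and $F=\{F_b\}_{b=1}^{n_F}$ on $\mathbb{C}^d$ put $$\Upsilon_p(E,F)=\sum_{a,b}\|[E_a,F_b]\|_p,\qquad [X,Y]=XY-YX .$$ Then the following hold. 1. For every $d$, the maximum of $\Upsilon_p(E,F)$ over all pairs of measurements on $\mathbb{C}^d$ (with arbitrary finite numbers of outcomes) exists and equals $2^{1/p}\,d\sqrt{d-1}$. 2. If at least one of the operators $E_a$, $F_b$ has rank strictly larger than $1$, then the maximum is not achieved: $\Upsilon_p(E,F)<2^{1/p}\,d\sqrt{d-1}$. 3. If $\Upsilon_p(E,F)=2^{1/p}\,d\sqrt{d-1}$, then all $E_a$ and all $F_b$ have rank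 $1$; they can thus be written as $E_a=\alpha_a|e_a\rangle\langle e_a|$ and $F_b=\beta_b|f_b\rangle\langle f_b|$ with $\alpha_a,\beta_b\ge 0$ and unit vectors $e_a,f_b$, and for all such representations $|\langle e_a|f_b\rangle|=\frac{1}{\sqrt d}$ for all $a,b$. 4. Let $\{|0\rangle,|1\rangle,|2\rangle\}$ be an orthonormal basis of $\mathbb{C}^3$, let $\gamma\in(0,1]$, let $a,b,c\in\mathbb{C}$ with $ab\neq 0$, and let $P_0=|0\rangle\langle 0|$, $P_1=\gamma|1\rangle\langle 1|$, $Q=|\psi\rangle\langle\psi|$ with $|\psi\rangle=a|0\rangle+b|1\rangle+c|2\rangle$, $A=i[P_0,Q]$, $B=i[P_1,Q]$. Then $$\|A+B\|_p<\|A\|_p+\|B\|_p .$$ -/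

import Mathlib

namespace QIncompat

open scoped ENNReal ComplexOrder

/-- The Schatten `p`-norm (`p ∈ [1, ∞]`) of a complex `d × d` matrix: the `ℓ^p` norm of the vector
of its `d` singular values, counted with multiplicity. -/
noncomputable def schattenNorm {d : ℕ} (p : ℝ≥0∞) (A : Matrix (Fin d) (Fin d) ℂ) : ℝ :=
  if p = ∞ then ⨆ j : Fin d, (Matrix.toEuclideanLin A).singularValues j
  else (∑ j : Fin d, (Matrix.toEuclideanLin A).singularValues j ^ p.toReal) ^ (1 / p.toReal)

/-- A quantum measurement (POVM) with `n` outcomes on `ℂ^d`, all of whose measurement operators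
are non-zero. -/
structure Measurement (d n : ℕ) where
  op : Fin n → Matrix (Fin d) (Fin d) ℂ
  posSemidef : ∀ a, (op a).PosSemidef
  sum_eq_one : ∑ a, op a = 1
  ne_zero : ∀ a, op a ≠ 0

/-- The incompatibility measure `Υ_p(E, F) = ∑_{a,b} ‖[E_a, F_b]‖_p`. -/
noncomputable def incompatibility {d nE nF : ℕ} (p : ℝ≥0∞)
    (E : Measurement d nE) (F : Measurement d nF) : ℝ :=
  ∑ a, ∑ b, schattenNorm p ⁅E.op a, F.op b⁆

/-- The number `2^{1/p} d √(d - 1)`; for `p = ∞` the exponent `1/p` is `0`. -/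
noncomputable def maxValue (p : ℝ≥0∞) (d : ℕ) : ℝ :=
  (2 : ℝ) ^ (p⁻¹).toReal * d * √((d : ℝ) - 1)

/-- The operator `|x⟩⟨x|`. -/
noncomputable def ketbra {d : ℕ} (x : EuclideanSpace ℂ (Fin d)) : Matrix (Fin d) (Fin d) ℂ :=
  Matrix.vecMulVec (fun i => x i) (fun j => star (x j))

/-- A measurement is rank-1 if each of its operators has rank one. -/
def Measurement.IsRankOne {d n : ℕ} (E : Measurement d n) : Prop :=
  ∀ a, (E.op a).rank = 1

/-- `E_a = α_a |e_a⟩⟨e_a|` for every outcome `a`, with `α_a ≥ 0` and `e_a` a unit vector. -/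
def Measurement.IsDecomposition {d n : ℕ} (E : Measurement d n)
    (α : Fin n → ℝ) (e : Fin n → EuclideanSpace ℂ (Fin d)) : Prop :=
  ∀ a, 0 ≤ α a ∧ ‖e a‖ = 1 ∧ E.op a = (α a : ℂ) • ketbra (e a)

end QIncompat

/-!
The commutator of a Hermitian `H` with `|ψ⟩⟨ψ|` is `|φ⟩⟨ψ| - |ψ⟩⟨φ|`, where `φ` is the component of
`H ψ` orthogonal to `ψ`. Its non-zero singular values are `Λ, Λ` with `Λ = ‖φ‖ ‖ψ‖`, which gives the
factor `2^{1/p}` for every `p` at once (`schattenNorm_smul_commutator`). For a sum of such operators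
no triangle inequality for the Schatten norms is needed: by the singular value decomposition
`σ_j = ⟨v_j, T w_j⟩` every singular value is at most `∑ Λ` and their sum is at most `2 ∑ Λ`
(`SkewBounded`), and these two bounds control every `ℓ^p` norm
(`schattenNorm_le_of_singularValues_le`).

Refine both measurements into rank-one pieces `|x⟩⟨x|`, `|y⟩⟨y|`. With `s = |⟨x, y⟩|²` and
`r = ‖x‖² ‖y‖²` the incompatibility is at most `2^{1/p} ∑ √(s (r - s))`, while `∑ s = d` and
`∑ r = d²`. The inequality of means gives `∑ √(s (r - s)) ≤ d √(d - 1)`, and equality forces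
`r = d s` for every pair (`incompatibility_le_and_rigid`). For a maximal pair this holds for *every*
choice of refinements. For rank-one operators it says that the overlaps are `1 / √d`. An operator of
rank at least two can be refined by a non-zero `x` orthogonal to some non-zero `y`, which is
incompatible with `r = d s` (`rank_le_one_of_incompatibility_eq`). The standard basis and the
Fourier basis attain the bound.

In dimension three, the three norms are given explicitly by `commutatorSize_two_ketbra`, and the
claim reduces to the negativity of one inner product.
-/

namespace QIncompat

open scoped ENNReal ComplexOrder InnerProductSpace

/-! ### Singular values and Schatten norms -/

/-- A form of the singular value decomposition. The left singular vectors `v i` are set to zero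
where the singular value vanishes, so they only form a Bessel family. -/
theorem exists_singularValues_eq_inner {d : ℕ}
    (T : EuclideanSpace ℂ (Fin d) →ₗ[ℂ] EuclideanSpace ℂ (Fin d)) :
    ∃ (w : OrthonormalBasis (Fin d) ℂ (EuclideanSpace ℂ (Fin d)))
      (v : Fin d → EuclideanSpace ℂ (Fin d)),
      (∀ x, ∑ i, ‖⟪v i, x⟫_ℂ‖ ^ 2 ≤ ‖x‖ ^ 2) ∧
      (∀ i, ‖⟪v i, T (w i)⟫_ℂ‖ = T.singularValues i) ∧
      (∀ i, ‖T (w i)‖ = T.singularValues i) := by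
  have hn : Module.finrank ℂ (EuclideanSpace ℂ (Fin d)) = d := by simp
  set w := T.isSymmetric_adjoint_comp_self.eigenvectorBasis hn with hw
  set σ : Fin d → ℝ := fun i => T.singularValues i with hσ
  have hσ0 : ∀ i, 0 ≤ σ i := fun i => T.singularValues_nonneg i
  have hinner : ∀ i j, ⟪T (w i), T (w j)⟫_ℂ = if i = j then (σ j : ℂ) ^ 2 else 0 := by
    intro i j
    have h1 : T.adjoint (T (w j)) = ((σ j : ℂ) ^ 2) • w j := by
      rw [← LinearMap.comp_apply, hw, T.isSymmetric_adjoint_comp_self.apply_eigenvectorBasis hn j,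
        ← T.sq_singularValues_fin hn j]
      push_cast
      rfl
    rw [← LinearMap.adjoint_inner_right, h1, inner_smul_right, orthonormal_iff_ite.1 w.orthonormal]
    simp
  have hnorm : ∀ i, ‖T (w i)‖ = σ i := by
    intro i
    have h := hinner i i
    rw [inner_self_eq_norm_sq_to_K] at h
    simp only [if_true] at h
    have h' : ‖T (w i)‖ ^ 2 = σ i ^ 2 := by
      apply Complex.ofReal_injective
      push_cast
      exact h
    exact (sq_eq_sq₀ (norm_nonneg _) (hσ0 i)).1 h'
  refine ⟨w, fun i => ((σ i : ℂ)⁻¹) • T (w i), ?_, ?_, hnorm⟩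
  · intro x
    -- the vectors with `σ i ≠ 0` are orthonormal and the others vanish
    have ho : Orthonormal ℂ (fun i : {i // σ i ≠ 0} => ((σ i : ℂ)⁻¹) • T (w i)) := by
      rw [orthonormal_iff_ite]
      rintro ⟨i, hi⟩ ⟨j, hj⟩
      rw [inner_smul_left, inner_smul_right, hinner]
      have hj' : (σ j : ℂ) ≠ 0 := by exact_mod_cast hj
      by_cases hij : i = j
      · subst hij
        simp
        field_simp
      · simp [hij]
    refine le_trans (le_of_eq ?_) (ho.sum_inner_products_le (s := Finset.univ) x)
    rw [← Finset.sum_subtype (Finset.univ.filter fun i => σ i ≠ 0) (by simp)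
      (fun i => ‖⟪((σ i : ℂ)⁻¹) • T (w i), x⟫_ℂ‖ ^ 2), Finset.sum_filter_of_ne]
    intro i _ h h0
    simp [h0] at h
  · intro i
    by_cases h : σ i = 0
    · simp [h]
      exact h.symm
    · have hj' : (σ i : ℂ) ≠ 0 := by exact_mod_cast h
      rw [inner_smul_left, hinner]
      have : (starRingEnd ℂ) ((σ i : ℂ)⁻¹) * (σ i : ℂ) ^ 2 = σ i := by
        simp
        field_simp
      simp only [if_true, this]
      simp [abs_of_nonneg (hσ0 i)]
      rfl

/-- The numerical core of the upper bound: control of the largest and of the sum of the singular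
values interpolates to all `p`. -/
theorem schattenNorm_le_of_singularValues_le {d : ℕ} {p : ℝ≥0∞} (hp : 1 ≤ p)
    {A : Matrix (Fin d) (Fin d) ℂ} {Λ : ℝ} (hΛ : 0 ≤ Λ)
    (h1 : ∀ i : Fin d, (Matrix.toEuclideanLin A).singularValues i ≤ Λ)
    (h2 : ∑ i : Fin d, (Matrix.toEuclideanLin A).singularValues i ≤ 2 * Λ) :
    schattenNorm p A ≤ (2 : ℝ) ^ (p⁻¹).toReal * Λ := by
  set σ : Fin d → ℝ := fun i => (Matrix.toEuclideanLin A).singularValues i with hσ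
  have hσ0 : ∀ i, 0 ≤ σ i := fun i => LinearMap.singularValues_nonneg _ i
  unfold schattenNorm
  split_ifs with h
  · subst h
    simpa using Real.iSup_le h1 hΛ
  · have hq : 1 ≤ p.toReal := by simpa using ENNReal.toReal_mono h hp
    set q := p.toReal
    have hq0 : 0 < q := by linarith
    have key : ∑ i, σ i ^ q ≤ 2 * Λ ^ q := by
      have hs : ∀ x : ℝ, 0 ≤ x → x ^ q = x ^ (q - 1) * x := by
        intro x hx
        conv_lhs => rw [show q = (q - 1) + 1 by ring]
        rw [Real.rpow_add_of_nonneg hx (by linarith) (by norm_num), Real.rpow_one]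
      calc ∑ i, σ i ^ q ≤ ∑ i, Λ ^ (q - 1) * σ i := by
            refine Finset.sum_le_sum fun i _ => ?_
            rw [hs _ (hσ0 i)]
            exact mul_le_mul_of_nonneg_right
              (Real.rpow_le_rpow (hσ0 i) (h1 i) (by linarith)) (hσ0 i)
        _ = Λ ^ (q - 1) * ∑ i, σ i := by rw [Finset.mul_sum]
        _ ≤ Λ ^ (q - 1) * (2 * Λ) :=
            mul_le_mul_of_nonneg_left h2 (Real.rpow_nonneg hΛ _)
        _ = 2 * Λ ^ q := by rw [hs _ hΛ]; ring
    rw [ENNReal.toReal_inv, ← one_div]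
    calc (∑ i, σ i ^ q) ^ (1 / q) ≤ (2 * Λ ^ q) ^ (1 / q) :=
          Real.rpow_le_rpow (Finset.sum_nonneg fun i _ => Real.rpow_nonneg (hσ0 i) _) key
            (by positivity)
      _ = 2 ^ (1 / q) * Λ := by
          rw [Real.mul_rpow (by norm_num) (Real.rpow_nonneg hΛ _), one_div,
            Real.rpow_rpow_inv hΛ hq0.ne']

/-- If moreover the Frobenius norm is `√2 Λ`, then every singular value is `0` or `Λ`, and
their sum is `2 Λ`. -/
theorem schattenNorm_eq_of_singularValues_le {d : ℕ} {p : ℝ≥0∞} (hp : 1 ≤ p)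
    {A : Matrix (Fin d) (Fin d) ℂ} {Λ : ℝ} (hΛ : 0 ≤ Λ)
    (h1 : ∀ i : Fin d, (Matrix.toEuclideanLin A).singularValues i ≤ Λ)
    (h2 : ∑ i : Fin d, (Matrix.toEuclideanLin A).singularValues i ≤ 2 * Λ)
    (h3 : ∑ i : Fin d, (Matrix.toEuclideanLin A).singularValues i ^ 2 = 2 * Λ ^ 2) :
    schattenNorm p A = (2 : ℝ) ^ (p⁻¹).toReal * Λ := by
  refine le_antisymm (schattenNorm_le_of_singularValues_le hp hΛ h1 h2) ?_
  set σ : Fin d → ℝ := fun i => (Matrix.toEuclideanLin A).singularValues i with hσ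
  have hσ0 : ∀ i, 0 ≤ σ i := fun i => LinearMap.singularValues_nonneg _ i
  -- `∑ σ (Λ - σ)` has non-negative terms and is at most `2 Λ² - 2 Λ² = 0`
  have hnn : ∀ i ∈ Finset.univ, 0 ≤ σ i * (Λ - σ i) := fun i _ =>
    mul_nonneg (hσ0 i) (sub_nonneg.2 (h1 i))
  have hsum : ∑ i, σ i * (Λ - σ i) = (∑ i, σ i) * Λ - 2 * Λ ^ 2 := by
    rw [← h3, Finset.sum_mul, ← Finset.sum_sub_distrib]
    exact Finset.sum_congr rfl fun i _ => by simp only [hσ]; ring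
  have hle : (∑ i, σ i) * Λ ≤ 2 * Λ ^ 2 := by nlinarith
  have hzero : ∑ i, σ i * (Λ - σ i) = 0 :=
    le_antisymm (by linarith) (Finset.sum_nonneg hnn)
  have hcase : ∀ i, σ i = 0 ∨ σ i = Λ := by
    intro i
    rcases mul_eq_zero.1 ((Finset.sum_eq_zero_iff_of_nonneg hnn).1 hzero i (Finset.mem_univ i))
      with h | h
    · exact Or.inl h
    · exact Or.inr (by linarith)
  have hnorm0 : 0 ≤ schattenNorm p A := by
    unfold schattenNorm
    split_ifs
    · exact Real.iSup_nonneg hσ0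
    · exact Real.rpow_nonneg (Finset.sum_nonneg fun i _ => Real.rpow_nonneg (hσ0 i) _) _
  rcases hΛ.eq_or_lt with h0 | hpos
  · simpa [← h0] using hnorm0
  have hsum2 : ∑ i, σ i = 2 * Λ := by
    have : (∑ i, σ i) * Λ = (2 * Λ) * Λ := by linarith
    exact mul_right_cancel₀ hpos.ne' this
  unfold schattenNorm
  split_ifs with h
  · subst h
    obtain ⟨i, hi⟩ : ∃ i, σ i = Λ := by
      by_contra! hne
      have : ∑ i, σ i = 0 := Finset.sum_eq_zero fun i _ => (hcase i).resolve_right (hne i)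
      linarith
    simp only [ENNReal.inv_top, ENNReal.toReal_zero, Real.rpow_zero, one_mul]
    rw [← hi]
    exact le_ciSup (f := σ) (Set.finite_range σ).bddAbove i
  · have hq : 1 ≤ p.toReal := by simpa using ENNReal.toReal_mono h hp
    set q := p.toReal
    have hq0 : 0 < q := by linarith
    have key : ∑ i, σ i ^ q = 2 * Λ ^ q := by
      have hs : ∀ i, σ i ^ q = Λ ^ (q - 1) * σ i := by
        intro i
        rcases hcase i with hi | hi
        · simp [hi, Real.zero_rpow hq0.ne']
        · rw [hi, Real.rpow_sub_one hpos.ne']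
          field_simp
      rw [Finset.sum_congr rfl fun i _ => hs i, ← Finset.mul_sum, hsum2,
        Real.rpow_sub_one hpos.ne']
      field_simp
    rw [ENNReal.toReal_inv, ← one_div]
    change _ ≤ (∑ i, σ i ^ q) ^ (1 / q)
    rw [key, Real.mul_rpow (by norm_num) (Real.rpow_nonneg hΛ _), one_div,
      Real.rpow_rpow_inv hΛ hq0.ne']

/-! ### Commutators with rank-one operators -/

/-- `T` is a "skew rank-two operator of size at most `Λ`" as far as its singular values are
concerned: tested against any orthonormal basis and any Bessel family, its diagonal entries are at
most `Λ` and add up to at most `2 Λ` in absolute value. -/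
def SkewBounded {d : ℕ} (T : EuclideanSpace ℂ (Fin d) →ₗ[ℂ] EuclideanSpace ℂ (Fin d))
    (Λ : ℝ) : Prop :=
  ∀ (w : OrthonormalBasis (Fin d) ℂ (EuclideanSpace ℂ (Fin d)))
    (v : Fin d → EuclideanSpace ℂ (Fin d)),
    (∀ x, ∑ i, ‖⟪v i, x⟫_ℂ‖ ^ 2 ≤ ‖x‖ ^ 2) →
      (∀ i, ‖⟪v i, T (w i)⟫_ℂ‖ ≤ Λ) ∧ ∑ i, ‖⟪v i, T (w i)⟫_ℂ‖ ≤ 2 * Λ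

theorem SkewBounded.sum {d : ℕ} {ι : Type*} (s : Finset ι)
    {T : ι → EuclideanSpace ℂ (Fin d) →ₗ[ℂ] EuclideanSpace ℂ (Fin d)} {Λ : ι → ℝ}
    (h : ∀ k ∈ s, SkewBounded (T k) (Λ k)) : SkewBounded (∑ k ∈ s, T k) (∑ k ∈ s, Λ k) := by
  intro w v hv
  have hle : ∀ i, ‖⟪v i, (∑ k ∈ s, T k) (w i)⟫_ℂ‖ ≤ ∑ k ∈ s, ‖⟪v i, T k (w i)⟫_ℂ‖ := by
    intro i
    rw [LinearMap.sum_apply, inner_sum]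
    exact norm_sum_le _ _
  refine ⟨fun i => (hle i).trans (Finset.sum_le_sum fun k hk => (h k hk w v hv).1 i), ?_⟩
  calc _ ≤ ∑ i, ∑ k ∈ s, ‖⟪v i, T k (w i)⟫_ℂ‖ := Finset.sum_le_sum fun i _ => hle i
    _ = ∑ k ∈ s, ∑ i, ‖⟪v i, T k (w i)⟫_ℂ‖ := Finset.sum_comm
    _ ≤ ∑ k ∈ s, 2 * Λ k := Finset.sum_le_sum fun k hk => (h k hk w v hv).2
    _ = 2 * ∑ k ∈ s, Λ k := by rw [Finset.mul_sum]

theorem SkewBounded.smul {d : ℕ} {c : ℂ} (hc : ‖c‖ = 1)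
    {T : EuclideanSpace ℂ (Fin d) →ₗ[ℂ] EuclideanSpace ℂ (Fin d)} {Λ : ℝ}
    (h : SkewBounded T Λ) : SkewBounded (c • T) Λ := by
  intro w v hv
  simpa [inner_smul_right, hc] using h w v hv

theorem SkewBounded.schattenNorm_le {d : ℕ} {p : ℝ≥0∞} (hp : 1 ≤ p)
    {A : Matrix (Fin d) (Fin d) ℂ} {Λ : ℝ} (hΛ : 0 ≤ Λ)
    (h : SkewBounded (Matrix.toEuclideanLin A) Λ) :
    schattenNorm p A ≤ (2 : ℝ) ^ (p⁻¹).toReal * Λ := by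
  obtain ⟨w, v, hv, hσ, -⟩ := exists_singularValues_eq_inner (Matrix.toEuclideanLin A)
  have := h w v hv
  simp only [hσ] at this
  exact schattenNorm_le_of_singularValues_le hp hΛ this.1 this.2

/-- The Frobenius norm is tested on every orthonormal basis, so that the basis of right singular
vectors is among those considered. -/
theorem SkewBounded.schattenNorm_eq {d : ℕ} {p : ℝ≥0∞} (hp : 1 ≤ p)
    {A : Matrix (Fin d) (Fin d) ℂ} {Λ : ℝ} (hΛ : 0 ≤ Λ)
    (h : SkewBounded (Matrix.toEuclideanLin A) Λ)
    (hF : ∀ w : OrthonormalBasis (Fin d) ℂ (EuclideanSpace ℂ (Fin d)),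
      ∑ i, ‖Matrix.toEuclideanLin A (w i)‖ ^ 2 = 2 * Λ ^ 2) :
    schattenNorm p A = (2 : ℝ) ^ (p⁻¹).toReal * Λ := by
  obtain ⟨w, v, hv, hσ, hσ'⟩ := exists_singularValues_eq_inner (Matrix.toEuclideanLin A)
  have h' := h w v hv
  have hF' := hF w
  simp only [hσ] at h'
  simp only [hσ'] at hF'
  exact schattenNorm_eq_of_singularValues_le hp hΛ h'.1 h'.2 hF'

theorem norm_sq_skew_of_orthogonal {V : Type*} [NormedAddCommGroup V] [InnerProductSpace ℂ V]
    {φ ψ : V} (h : ⟪ψ, φ⟫_ℂ = 0) (z : V) :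
    ‖⟪ψ, z⟫_ℂ • φ - ⟪φ, z⟫_ℂ • ψ‖ ^ 2 =
      ‖⟪ψ, z⟫_ℂ‖ ^ 2 * ‖φ‖ ^ 2 + ‖⟪φ, z⟫_ℂ‖ ^ 2 * ‖ψ‖ ^ 2 := by
  have h' : ⟪φ, ψ⟫_ℂ = 0 := by rw [← inner_conj_symm, h, map_zero]
  have := norm_sub_sq (𝕜 := ℂ) (⟪ψ, z⟫_ℂ • φ) (⟪φ, z⟫_ℂ • ψ)
  rw [this, inner_smul_left, inner_smul_right, h', norm_smul, norm_smul]
  simp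
  ring

theorem norm_skew_le_of_orthogonal {V : Type*} [NormedAddCommGroup V] [InnerProductSpace ℂ V]
    {φ ψ : V} (h : ⟪ψ, φ⟫_ℂ = 0) (z : V) :
    ‖⟪ψ, z⟫_ℂ • φ - ⟪φ, z⟫_ℂ • ψ‖ ≤ ‖φ‖ * ‖ψ‖ * ‖z‖ := by
  have h' : ⟪φ, ψ⟫_ℂ = 0 := by rw [← inner_conj_symm, h, map_zero]
  set S := ‖⟪ψ, z⟫_ℂ‖ ^ 2 * ‖φ‖ ^ 2 + ‖⟪φ, z⟫_ℂ‖ ^ 2 * ‖ψ‖ ^ 2 with hS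
  have hS0 : 0 ≤ S := by positivity
  -- Cauchy–Schwarz against a multiple of the projection of `z` to the span of `φ` and `ψ`
  set u : V := ((‖φ‖ ^ 2 : ℝ) * ⟪ψ, z⟫_ℂ) • ψ + ((‖ψ‖ ^ 2 : ℝ) * ⟪φ, z⟫_ℂ) • φ with hu
  have h1 : ⟪u, z⟫_ℂ = (S : ℂ) := by
    rw [hu, inner_add_left, inner_smul_left, inner_smul_left, hS]
    simp only [map_mul, Complex.conj_ofReal]
    push_cast
    rw [← Complex.conj_mul' ⟪ψ, z⟫_ℂ, ← Complex.conj_mul' ⟪φ, z⟫_ℂ]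
    ring
  have h2 : ‖u‖ ^ 2 = (‖φ‖ * ‖ψ‖) ^ 2 * S := by
    have := norm_add_sq (𝕜 := ℂ) (((‖φ‖ ^ 2 : ℝ) * ⟪ψ, z⟫_ℂ) • ψ) (((‖ψ‖ ^ 2 : ℝ) * ⟪φ, z⟫_ℂ) • φ)
    rw [hu, this, inner_smul_left, inner_smul_right, h, norm_smul, norm_smul, hS]
    simp
    ring
  have h3 : S ≤ ‖u‖ * ‖z‖ := by
    have := norm_inner_le_norm (𝕜 := ℂ) u z
    rwa [h1, Complex.norm_real, Real.norm_of_nonneg hS0] at this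
  have h4 : S ≤ (‖φ‖ * ‖ψ‖ * ‖z‖) ^ 2 := by
    rcases hS0.eq_or_lt with h0 | hpos
    · rw [← h0]; positivity
    · have : S * S ≤ (‖φ‖ * ‖ψ‖ * ‖z‖) ^ 2 * S := by
        calc S * S ≤ (‖u‖ * ‖z‖) * (‖u‖ * ‖z‖) := mul_self_le_mul_self hS0 h3
          _ = ‖u‖ ^ 2 * ‖z‖ ^ 2 := by ring
          _ = _ := by rw [h2]; ring
      exact le_of_mul_le_mul_right this hpos
  refine le_of_sq_le_sq ?_ (by positivity)
  rwa [norm_sq_skew_of_orthogonal h]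

theorem skewBounded_of_orthogonal {d : ℕ} {φ ψ : EuclideanSpace ℂ (Fin d)} (h : ⟪ψ, φ⟫_ℂ = 0)
    {T : EuclideanSpace ℂ (Fin d) →ₗ[ℂ] EuclideanSpace ℂ (Fin d)}
    (hT : ∀ z, T z = ⟪ψ, z⟫_ℂ • φ - ⟪φ, z⟫_ℂ • ψ) : SkewBounded T (‖φ‖ * ‖ψ‖) := by
  intro w v hv
  constructor
  · intro i
    have hvi : ‖v i‖ ≤ 1 := by
      have h1 : ‖⟪v i, v i⟫_ℂ‖ ^ 2 ≤ ‖v i‖ ^ 2 :=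
        (Finset.single_le_sum (f := fun j => ‖⟪v j, v i⟫_ℂ‖ ^ 2) (fun _ _ => by positivity)
          (Finset.mem_univ i)).trans (hv (v i))
      rw [inner_self_eq_norm_sq_to_K] at h1
      have h2 : (‖v i‖ ^ 2) ^ 2 ≤ ‖v i‖ ^ 2 := by simpa using h1
      by_contra! hlt
      nlinarith [mul_pos (show 0 < ‖v i‖ ^ 2 by positivity) (show 0 < ‖v i‖ ^ 2 - 1 by nlinarith)]
    calc ‖⟪v i, T (w i)⟫_ℂ‖ ≤ ‖v i‖ * ‖T (w i)‖ := norm_inner_le_norm _ _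
      _ ≤ 1 * (‖φ‖ * ‖ψ‖ * ‖w i‖) := by
          rw [hT]
          exact mul_le_mul hvi (norm_skew_le_of_orthogonal h _) (norm_nonneg _) zero_le_one
      _ = ‖φ‖ * ‖ψ‖ := by simp
  · have hle : ∀ i, ‖⟪v i, T (w i)⟫_ℂ‖ ≤
        ‖⟪ψ, w i⟫_ℂ‖ * ‖⟪v i, φ⟫_ℂ‖ + ‖⟪φ, w i⟫_ℂ‖ * ‖⟪v i, ψ⟫_ℂ‖ := by
      intro i
      rw [hT, inner_sub_right, inner_smul_right, inner_smul_right]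
      exact (norm_sub_le _ _).trans (by simp)
    have hcs : ∀ x y : EuclideanSpace ℂ (Fin d),
        ∑ i, ‖⟪x, w i⟫_ℂ‖ * ‖⟪v i, y⟫_ℂ‖ ≤ ‖x‖ * ‖y‖ := by
      intro x y
      refine (Real.sum_mul_le_sqrt_mul_sqrt _ _ _).trans ?_
      refine mul_le_mul (le_of_eq ?_) ?_ (Real.sqrt_nonneg _) (norm_nonneg _)
      · rw [w.sum_sq_norm_inner_left, Real.sqrt_sq (norm_nonneg _)]
      · exact Real.sqrt_le_iff.2 ⟨norm_nonneg _, hv y⟩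
    calc _ ≤ ∑ i, (‖⟪ψ, w i⟫_ℂ‖ * ‖⟪v i, φ⟫_ℂ‖ + ‖⟪φ, w i⟫_ℂ‖ * ‖⟪v i, ψ⟫_ℂ‖) :=
          Finset.sum_le_sum fun i _ => hle i
      _ ≤ ‖ψ‖ * ‖φ‖ + ‖φ‖ * ‖ψ‖ := by
          rw [Finset.sum_add_distrib]
          exact add_le_add (hcs _ _) (hcs _ _)
      _ = 2 * (‖φ‖ * ‖ψ‖) := by ring

theorem sum_norm_sq_skew_of_orthogonal {d : ℕ} {φ ψ : EuclideanSpace ℂ (Fin d)}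
    (h : ⟪ψ, φ⟫_ℂ = 0) (w : OrthonormalBasis (Fin d) ℂ (EuclideanSpace ℂ (Fin d))) :
    ∑ i, ‖⟪ψ, w i⟫_ℂ • φ - ⟪φ, w i⟫_ℂ • ψ‖ ^ 2 = 2 * (‖φ‖ * ‖ψ‖) ^ 2 := by
  simp only [norm_sq_skew_of_orthogonal h]
  rw [Finset.sum_add_distrib, ← Finset.sum_mul, ← Finset.sum_mul, w.sum_sq_norm_inner_left,
    w.sum_sq_norm_inner_left]
  ring

theorem toEuclideanLin_ketbra {d : ℕ} (x z : EuclideanSpace ℂ (Fin d)) :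
    Matrix.toEuclideanLin (ketbra x) z = ⟪x, z⟫_ℂ • x := by
  ext i
  simp [ketbra, Matrix.toLpLin_apply, Matrix.vecMulVec_mulVec, EuclideanSpace.inner_eq_star_dotProduct,
    dotProduct_comm]
  simp [dotProduct]

theorem toEuclideanLin_commutator_ketbra {d : ℕ} {H : Matrix (Fin d) (Fin d) ℂ}
    (hH : H.IsHermitian) (ψ z : EuclideanSpace ℂ (Fin d)) :
    Matrix.toEuclideanLin ⁅H, ketbra ψ⁆ z =
      ⟪ψ, z⟫_ℂ • Matrix.toEuclideanLin H ψ - ⟪Matrix.toEuclideanLin H ψ, z⟫_ℂ • ψ := by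
  have hs : (Matrix.toEuclideanLin H).IsSymmetric := Matrix.isSymmetric_toEuclideanLin_iff.2 hH
  have hmul : ∀ A B : Matrix (Fin d) (Fin d) ℂ, Matrix.toEuclideanLin (A * B) z =
      Matrix.toEuclideanLin A (Matrix.toEuclideanLin B z) := by
    intro A B
    simp [Matrix.toLpLin_apply]
  rw [Ring.lie_def, map_sub, LinearMap.sub_apply, hmul, hmul, toEuclideanLin_ketbra,
    toEuclideanLin_ketbra, map_smul, hs]

/-- The largest singular value, of multiplicity two unless it vanishes, of the commutator of a Hermitian matrix `H`
with `|ψ⟩⟨ψ|`: the norm of `ψ` times the norm of the component of `H ψ` orthogonal to `ψ`. -/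
noncomputable def commutatorSize {d : ℕ} (H : Matrix (Fin d) (Fin d) ℂ)
    (ψ : EuclideanSpace ℂ (Fin d)) : ℝ :=
  √(‖Matrix.toEuclideanLin H ψ‖ ^ 2 * ‖ψ‖ ^ 2 - (⟪ψ, Matrix.toEuclideanLin H ψ⟫_ℂ).re ^ 2)

theorem commutatorSize_nonneg {d : ℕ} (H : Matrix (Fin d) (Fin d) ℂ)
    (ψ : EuclideanSpace ℂ (Fin d)) : 0 ≤ commutatorSize H ψ := Real.sqrt_nonneg _

/-- Since `⟨ψ, H ψ⟩` is real, replacing `H ψ` by its component orthogonal to `ψ` does not change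
the commutator. -/
theorem exists_orthogonal_commutator {d : ℕ} {H : Matrix (Fin d) (Fin d) ℂ}
    (hH : H.IsHermitian) (ψ : EuclideanSpace ℂ (Fin d)) :
    ∃ φ : EuclideanSpace ℂ (Fin d), ⟪ψ, φ⟫_ℂ = 0 ∧ ‖φ‖ * ‖ψ‖ = commutatorSize H ψ ∧
      ∀ z, Matrix.toEuclideanLin ⁅H, ketbra ψ⁆ z = ⟪ψ, z⟫_ℂ • φ - ⟪φ, z⟫_ℂ • ψ := by
  have hs : (Matrix.toEuclideanLin H).IsSymmetric := Matrix.isSymmetric_toEuclideanLin_iff.2 hH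
  set φ := Matrix.toEuclideanLin H ψ with hφ
  set r := (⟪ψ, φ⟫_ℂ).re with hr
  have hr' : ⟪ψ, φ⟫_ℂ = (r : ℂ) := by
    rw [hr, eq_comm, ← Complex.conj_eq_iff_re, inner_conj_symm, hφ, hs]
  rcases eq_or_ne ψ 0 with h0 | h0
  · refine ⟨0, by simp, ?_, ?_⟩
    · simp [commutatorSize, h0]
    · intro z
      rw [toEuclideanLin_commutator_ketbra hH]
      simp [h0]
  have hN : ‖ψ‖ ≠ 0 := norm_ne_zero_iff.2 h0
  have hNc : (‖ψ‖ : ℂ) ≠ 0 := by exact_mod_cast hN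
  set t : ℝ := r / ‖ψ‖ ^ 2 with ht
  have horth : ⟪ψ, φ - (t : ℂ) • ψ⟫_ℂ = 0 := by
    rw [inner_sub_right, inner_smul_right, inner_self_eq_norm_sq_to_K, hr', ht]
    push_cast
    simp
    field_simp
    simp
  refine ⟨φ - (t : ℂ) • ψ, horth, ?_, ?_⟩
  · have hpyth : ‖φ‖ ^ 2 = ‖φ - (t : ℂ) • ψ‖ ^ 2 + t ^ 2 * ‖ψ‖ ^ 2 := by
      have h1 := norm_add_sq (𝕜 := ℂ) ((t : ℂ) • ψ) (φ - (t : ℂ) • ψ)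
      rw [add_sub_cancel, inner_smul_left, horth, norm_smul, Complex.norm_real, mul_pow,
        Real.norm_eq_abs, sq_abs] at h1
      rw [h1]
      simp
      ring
    have hsq : ‖φ‖ ^ 2 * ‖ψ‖ ^ 2 - r ^ 2 = (‖φ - (t : ℂ) • ψ‖ * ‖ψ‖) ^ 2 := by
      have : r = t * ‖ψ‖ ^ 2 := by rw [ht]; field_simp
      rw [hpyth, this]
      ring
    rw [commutatorSize, ← hφ, ← hr, hsq, Real.sqrt_sq (by positivity)]
  · intro z
    rw [toEuclideanLin_commutator_ketbra hH, inner_sub_left, inner_smul_left, Complex.conj_ofReal,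
      smul_sub, sub_smul, smul_smul, ← hφ, mul_comm (t : ℂ)]
    abel

theorem skewBounded_commutator {d : ℕ} {H : Matrix (Fin d) (Fin d) ℂ}
    (hH : H.IsHermitian) (ψ : EuclideanSpace ℂ (Fin d)) :
    SkewBounded (Matrix.toEuclideanLin ⁅H, ketbra ψ⁆) (commutatorSize H ψ) := by
  obtain ⟨φ, h, hn, hT⟩ := exists_orthogonal_commutator hH ψ
  exact hn ▸ skewBounded_of_orthogonal h hT

theorem schattenNorm_smul_commutator {d : ℕ} {p : ℝ≥0∞} (hp : 1 ≤ p) {c : ℂ} (hc : ‖c‖ = 1)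
    {H : Matrix (Fin d) (Fin d) ℂ} (hH : H.IsHermitian) (ψ : EuclideanSpace ℂ (Fin d)) :
    schattenNorm p (c • ⁅H, ketbra ψ⁆) = (2 : ℝ) ^ (p⁻¹).toReal * commutatorSize H ψ := by
  refine SkewBounded.schattenNorm_eq hp (commutatorSize_nonneg _ _) ?_ ?_
  · rw [map_smul]
    exact (skewBounded_commutator hH ψ).smul hc
  · intro w
    obtain ⟨φ, h, hn, hT⟩ := exists_orthogonal_commutator hH ψ
    rw [← hn, ← sum_norm_sq_skew_of_orthogonal h w]
    simp [norm_smul, hc, hT]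

theorem isHermitian_ketbra {d : ℕ} (x : EuclideanSpace ℂ (Fin d)) : (ketbra x).IsHermitian := by
  ext i j
  simp [ketbra, Matrix.vecMulVec_apply, mul_comm]

theorem commutatorSize_ketbra {d : ℕ} (x y : EuclideanSpace ℂ (Fin d)) :
    commutatorSize (ketbra x) y =
      √(‖⟪x, y⟫_ℂ‖ ^ 2 * (‖x‖ ^ 2 * ‖y‖ ^ 2 - ‖⟪x, y⟫_ℂ‖ ^ 2)) := by
  unfold commutatorSize
  rw [toEuclideanLin_ketbra, inner_smul_right, norm_smul, ← inner_conj_symm y x,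
    Complex.mul_conj']
  congr 1
  norm_cast
  ring

/-! ### Rank-one refinements of measurements -/

/-- The vectors `x a k` refine the measurement `E` into rank-one pieces: `E_a = ∑ₖ |x a k⟩⟨x a k|`.
Zero vectors are allowed, so that all outcomes can share one index type. -/
def Measurement.IsRefinement {d n : ℕ} (E : Measurement d n) {ι : Type*} [Fintype ι]
    (x : Fin n → ι → EuclideanSpace ℂ (Fin d)) : Prop :=
  ∀ a, E.op a = ∑ k, ketbra (x a k)

theorem Measurement.IsRefinement.sum_norm_inner_sq {d n : ℕ} {E : Measurement d n} {ι : Type*}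
    [Fintype ι] {x : Fin n → ι → EuclideanSpace ℂ (Fin d)} (hx : E.IsRefinement x)
    (y : EuclideanSpace ℂ (Fin d)) : ∑ q : Fin n × ι, ‖⟪x q.1 q.2, y⟫_ℂ‖ ^ 2 = ‖y‖ ^ 2 := by
  have h1 : ∑ q : Fin n × ι, ketbra (x q.1 q.2) = 1 := by
    rw [← E.sum_eq_one, Fintype.sum_prod_type]
    exact Finset.sum_congr rfl fun a _ => (hx a).symm
  have h2 : ∑ q : Fin n × ι, ⟪x q.1 q.2, y⟫_ℂ • x q.1 q.2 = y := by
    have := congrArg (fun M => Matrix.toEuclideanLin M y) h1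
    simp only [map_sum, LinearMap.sum_apply, toEuclideanLin_ketbra] at this
    rw [this]
    simp
  have h3 := congrArg (fun z => ⟪y, z⟫_ℂ) h2
  simp only [inner_sum, inner_smul_right] at h3
  rw [inner_self_eq_norm_sq_to_K] at h3
  apply Complex.ofReal_injective
  push_cast
  refine Eq.trans (Finset.sum_congr rfl fun q _ => ?_) h3
  rw [← inner_conj_symm y, Complex.mul_conj']

theorem Measurement.IsRefinement.sum_norm_sq {d n : ℕ} {E : Measurement d n} {ι : Type*}
    [Fintype ι] {x : Fin n → ι → EuclideanSpace ℂ (Fin d)} (hx : E.IsRefinement x) :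
    ∑ q : Fin n × ι, ‖x q.1 q.2‖ ^ 2 = d := by
  let b := EuclideanSpace.basisFun (Fin d) ℂ
  calc ∑ q : Fin n × ι, ‖x q.1 q.2‖ ^ 2 = ∑ q : Fin n × ι, ∑ i, ‖⟪x q.1 q.2, b i⟫_ℂ‖ ^ 2 :=
        Finset.sum_congr rfl fun q _ => (b.sum_sq_norm_inner_left _).symm
    _ = ∑ i, ∑ q : Fin n × ι, ‖⟪x q.1 q.2, b i⟫_ℂ‖ ^ 2 := Finset.sum_comm
    _ = d := by simp [hx.sum_norm_inner_sq]

/-- The incompatibility is bounded by the one of any rank-one refinements; no triangle inequality for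
the Schatten norms enters, only additivity of `SkewBounded`. -/
theorem incompatibility_le_sum {d nE nF : ℕ} {p : ℝ≥0∞} (hp : 1 ≤ p)
    {E : Measurement d nE} {F : Measurement d nF} {ι κ : Type*} [Fintype ι] [Fintype κ]
    {x : Fin nE → ι → EuclideanSpace ℂ (Fin d)} {y : Fin nF → κ → EuclideanSpace ℂ (Fin d)}
    (hx : E.IsRefinement x) (hy : F.IsRefinement y) :
    incompatibility p E F ≤ (2 : ℝ) ^ (p⁻¹).toReal *
      ∑ q : (Fin nE × ι) × (Fin nF × κ),
        commutatorSize (ketbra (x q.1.1 q.1.2)) (y q.2.1 q.2.2) := by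
  have hab : ∀ a b, schattenNorm p ⁅E.op a, F.op b⁆ ≤ (2 : ℝ) ^ (p⁻¹).toReal *
      ∑ k, ∑ l, commutatorSize (ketbra (x a k)) (y b l) := by
    intro a b
    refine SkewBounded.schattenNorm_le hp
      (Finset.sum_nonneg fun k _ => Finset.sum_nonneg fun l _ => commutatorSize_nonneg _ _) ?_
    have hlie : ⁅∑ k, ketbra (x a k), ∑ l, ketbra (y b l)⁆ =
        ∑ k, ∑ l, ⁅ketbra (x a k), ketbra (y b l)⁆ := by
      simp only [Ring.lie_def, Finset.sum_sub_distrib]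
      rw [Finset.sum_mul_sum, Finset.sum_mul_sum]
      congr 1
      exact Finset.sum_comm
    rw [hx a, hy b, hlie, map_sum]
    refine SkewBounded.sum _ fun k _ => ?_
    rw [map_sum]
    exact SkewBounded.sum _ fun l _ => skewBounded_commutator (isHermitian_ketbra _) _
  unfold incompatibility
  refine (Finset.sum_le_sum fun a _ => Finset.sum_le_sum fun b _ => hab a b).trans (le_of_eq ?_)
  simp only [Fintype.sum_prod_type, Finset.mul_sum]
  refine Finset.sum_congr rfl fun a _ => ?_
  rw [Finset.sum_comm]

/-- A weighted inequality of arithmetic and geometric means, summed up, with its equality case. -/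
theorem sum_sqrt_mul_sub_le {ι : Type*} [Fintype ι] {s r : ι → ℝ} {D : ℝ} (hD : 1 ≤ D)
    (hs : ∀ i, 0 ≤ s i) (hsr : ∀ i, s i ≤ r i) (hs_sum : ∑ i, s i = D)
    (hr_sum : ∑ i, r i = D ^ 2) :
    ∑ i, √(s i * (r i - s i)) ≤ D * √(D - 1) ∧
      (∑ i, √(s i * (r i - s i)) = D * √(D - 1) → ∀ i, r i = D * s i) := by
  set c := √(D - 1) with hc
  have hc2 : c ^ 2 = D - 1 := Real.sq_sqrt (by linarith)
  have hc0 : 0 ≤ c := Real.sqrt_nonneg _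
  have hdiff : ∑ i, (r i - s i) = D * c ^ 2 := by
    rw [Finset.sum_sub_distrib, hr_sum, hs_sum, hc2]; ring
  rcases hc0.eq_or_lt with h0 | hpos
  · -- for `D = 1` the non-negative differences `r - s` sum to zero
    have hz : ∀ i, r i - s i = 0 := by
      have : ∑ i, (r i - s i) = 0 := by rw [hdiff, ← h0]; simp
      exact fun i => (Finset.sum_eq_zero_iff_of_nonneg fun i _ => sub_nonneg.2 (hsr i)).1 this i
        (Finset.mem_univ i)
    have hD1 : D = 1 := by rw [← h0] at hc2; linarith
    refine ⟨by simp [hz, ← h0], fun _ i => ?_⟩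
    rw [hD1]
    linarith [hz i]
  · -- the inequality of means for `c √s` and `√(r - s)`
    have hle : ∀ i ∈ Finset.univ, 2 * c * √(s i * (r i - s i)) ≤ c ^ 2 * s i + (r i - s i) := by
      intro i _
      rw [Real.sqrt_mul (hs i)]
      nlinarith [sq_nonneg (c * √(s i) - √(r i - s i)), Real.sq_sqrt (hs i),
        Real.sq_sqrt (sub_nonneg.2 (hsr i))]
    have hsum : ∑ i, (c ^ 2 * s i + (r i - s i)) = 2 * c * (D * c) := by
      rw [Finset.sum_add_distrib, ← Finset.mul_sum, hs_sum, hdiff]; ring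
    constructor
    · have := Finset.sum_le_sum hle
      rw [hsum, ← Finset.mul_sum] at this
      exact le_of_mul_le_mul_left this (by positivity)
    · intro heq i
      have hall := (Finset.sum_eq_sum_iff_of_le hle).1
        (by rw [hsum, ← Finset.mul_sum, heq]) i (Finset.mem_univ i)
      rw [Real.sqrt_mul (hs i)] at hall
      have h1 := Real.sq_sqrt (hs i)
      have h2 := Real.sq_sqrt (sub_nonneg.2 (hsr i))
      have h3 : (c * √(s i) - √(r i - s i)) ^ 2 = 0 := by
        calc _ = c ^ 2 * √(s i) ^ 2 + √(r i - s i) ^ 2 - 2 * c * (√(s i) * √(r i - s i)) := by ring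
          _ = 0 := by rw [h1, h2, hall]; ring
      have h4 : c * √(s i) = √(r i - s i) := sub_eq_zero.1 (pow_eq_zero_iff (by norm_num) |>.1 h3)
      have h5 : c ^ 2 * s i = r i - s i := by rw [← h2, ← h4, mul_pow, h1]
      rw [hc2] at h5
      linarith

/-- The upper bound together with its rigidity: for a maximal pair, *every* pair of rank-one
refinements has uniform overlaps. -/
theorem incompatibility_le_and_rigid {d nE nF : ℕ} (hd : 0 < d) {p : ℝ≥0∞} (hp : 1 ≤ p)
    {E : Measurement d nE} {F : Measurement d nF} {ι κ : Type*} [Fintype ι] [Fintype κ]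
    {x : Fin nE → ι → EuclideanSpace ℂ (Fin d)} {y : Fin nF → κ → EuclideanSpace ℂ (Fin d)}
    (hx : E.IsRefinement x) (hy : F.IsRefinement y) :
    incompatibility p E F ≤ maxValue p d ∧
      (incompatibility p E F = maxValue p d →
        ∀ a k b l, ‖x a k‖ ^ 2 * ‖y b l‖ ^ 2 = d * ‖⟪x a k, y b l⟫_ℂ‖ ^ 2) := by
  have hle := incompatibility_le_sum hp hx hy
  simp only [commutatorSize_ketbra] at hle
  have hc : (0 : ℝ) < (2 : ℝ) ^ (p⁻¹).toReal := by positivity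
  have hD : (1 : ℝ) ≤ d := by exact_mod_cast hd
  obtain ⟨h1, h2⟩ := sum_sqrt_mul_sub_le (ι := (Fin nE × ι) × (Fin nF × κ))
    (s := fun q => ‖⟪x q.1.1 q.1.2, y q.2.1 q.2.2⟫_ℂ‖ ^ 2)
    (r := fun q => ‖x q.1.1 q.1.2‖ ^ 2 * ‖y q.2.1 q.2.2‖ ^ 2) hD
    (fun q => by positivity)
    (fun q => by
      rw [← mul_pow]
      exact pow_le_pow_left₀ (norm_nonneg _) (norm_inner_le_norm _ _) 2)
    (by
      rw [Fintype.sum_prod_type, Finset.sum_comm]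
      simp only [hx.sum_norm_inner_sq, hy.sum_norm_sq])
    (by
      rw [Fintype.sum_prod_type]
      simp only [← Finset.mul_sum, ← Finset.sum_mul, hx.sum_norm_sq, hy.sum_norm_sq]
      rw [sq])
  have hmax : maxValue p d = (2 : ℝ) ^ (p⁻¹).toReal * (d * √((d : ℝ) - 1)) := by
    rw [maxValue, mul_assoc]
  rw [hmax]
  refine ⟨hle.trans (mul_le_mul_of_nonneg_left h1 hc.le), fun heq a k b l => ?_⟩
  rw [heq] at hle
  exact h2 (le_antisymm h1 (le_of_mul_le_mul_left hle hc)) ((a, k), (b, l))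

open scoped MatrixOrder in
theorem exists_sum_ketbra_of_posSemidef {d : ℕ} {A : Matrix (Fin d) (Fin d) ℂ}
    (hA : A.PosSemidef) : ∃ z : Fin d → EuclideanSpace ℂ (Fin d), A = ∑ k, ketbra (z k) := by
  obtain ⟨B, hB⟩ := CStarAlgebra.nonneg_iff_eq_star_mul_self.mp hA.nonneg
  refine ⟨fun k => WithLp.toLp 2 fun i => star (B k i), ?_⟩
  rw [hB]
  ext i j
  simp [Matrix.mul_apply, Matrix.sum_apply, ketbra, Matrix.vecMulVec_apply]

theorem Measurement.exists_isRefinement {d n : ℕ} (E : Measurement d n) :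
    ∃ x : Fin n → Fin d → EuclideanSpace ℂ (Fin d), E.IsRefinement x := by
  choose x hx using fun a => exists_sum_ketbra_of_posSemidef (E.posSemidef a)
  exact ⟨x, hx⟩

/-! ### Splitting off a vector and rigidity of the rank -/

theorem ketbra_smul {d : ℕ} (c : ℂ) (x : EuclideanSpace ℂ (Fin d)) :
    ketbra (c • x) = ((‖c‖ ^ 2 : ℝ) : ℂ) • ketbra x := by
  ext i j
  simp only [ketbra, Matrix.vecMulVec_apply, Matrix.smul_apply, PiLp.smul_apply, smul_eq_mul,
    star_mul']
  push_cast
  rw [← Complex.mul_conj']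
  simp only [RCLike.star_def]
  ring

theorem ketbra_mul_self_of_norm_eq_one {d : ℕ} {u : EuclideanSpace ℂ (Fin d)} (hu : ‖u‖ = 1) :
    ketbra u * ketbra u = ketbra u := by
  apply Matrix.toEuclideanLin.injective
  ext z : 1
  have hmul : Matrix.toEuclideanLin (ketbra u * ketbra u) z =
      Matrix.toEuclideanLin (ketbra u) (Matrix.toEuclideanLin (ketbra u) z) := by
    simp [Matrix.toLpLin_apply]
  rw [hmul, toEuclideanLin_ketbra u z, map_smul, toEuclideanLin_ketbra,
    inner_self_eq_norm_sq_to_K, hu]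
  simp

theorem conjTranspose_mul_ketbra_mul {d : ℕ} (B : Matrix (Fin d) (Fin d) ℂ)
    (u : EuclideanSpace ℂ (Fin d)) :
    B.conjTranspose * ketbra u * B = ketbra (Matrix.toEuclideanLin B.conjTranspose u) := by
  unfold ketbra
  rw [Matrix.mul_vecMulVec, Matrix.vecMulVec_mul]
  ext i j
  simp [Matrix.vecMulVec_apply, Matrix.mulVec, Matrix.vecMul, dotProduct, mul_comm,
    Matrix.toLpLin_apply]

open scoped MatrixOrder in
/-- Any non-zero direction in the range of a positive semidefinite matrix can be split off. -/
theorem exists_ketbra_add_sum_ketbra {d : ℕ} {A : Matrix (Fin d) (Fin d) ℂ} (hA : A.PosSemidef)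
    {v : EuclideanSpace ℂ (Fin d)} (hv : Matrix.toEuclideanLin A v ≠ 0) :
    ∃ (c : ℂ) (z : Fin d → EuclideanSpace ℂ (Fin d)), c ≠ 0 ∧
      A = ketbra (c • Matrix.toEuclideanLin A v) + ∑ k, ketbra (z k) := by
  obtain ⟨B, hB⟩ := CStarAlgebra.nonneg_iff_eq_star_mul_self.mp hA.nonneg
  rw [Matrix.star_eq_conjTranspose] at hB
  set u₀ := Matrix.toEuclideanLin B v with hu₀
  have hAv : Matrix.toEuclideanLin A v = Matrix.toEuclideanLin B.conjTranspose u₀ := by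
    rw [hu₀, hB]
    simp [Matrix.toLpLin_apply]
  have hu : u₀ ≠ 0 := by
    intro h
    rw [h, map_zero] at hAv
    exact hv hAv
  set c : ℂ := (‖u₀‖ : ℂ)⁻¹ with hc
  have hc0 : c ≠ 0 := inv_ne_zero (by exact_mod_cast norm_ne_zero_iff.2 hu)
  have hcu : ‖c • u₀‖ = 1 := by
    rw [norm_smul, hc]
    simp [norm_ne_zero_iff.2 hu]
  -- with `A = Bᴴ B` and the unit vector `u = c • B v`, the remainder is `Bᴴ (1 - |u⟩⟨u|) B`
  set P : Matrix (Fin d) (Fin d) ℂ := 1 - ketbra (c • u₀) with hP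
  have hPP : P = P.conjTranspose * P := by
    have h1 : P.conjTranspose = P := by
      rw [hP, Matrix.conjTranspose_sub, Matrix.conjTranspose_one, isHermitian_ketbra]
    rw [h1, hP, sub_mul, mul_sub, mul_sub, ketbra_mul_self_of_norm_eq_one hcu]
    simp
  have hpsd : (A - ketbra (c • Matrix.toEuclideanLin A v)).PosSemidef := by
    have : A - ketbra (c • Matrix.toEuclideanLin A v) = B.conjTranspose * P * B := by
      rw [hAv, ← map_smul, ← conjTranspose_mul_ketbra_mul, hP, mul_sub, sub_mul, mul_one, ← hB]
    rw [this, hPP]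
    exact (Matrix.posSemidef_conjTranspose_mul_self P).conjTranspose_mul_mul_same B
  obtain ⟨z, hz⟩ := exists_sum_ketbra_of_posSemidef hpsd
  exact ⟨c, z, hc0, by rw [← hz]; abel⟩

theorem exists_apply_ne_zero_inner_eq_zero {d : ℕ} {A : Matrix (Fin d) (Fin d) ℂ}
    (hA : 1 < A.rank) (y : EuclideanSpace ℂ (Fin d)) :
    ∃ v, Matrix.toEuclideanLin A v ≠ 0 ∧ ⟪y, Matrix.toEuclideanLin A v⟫_ℂ = 0 := by
  -- a functional on a space of dimension at least two has a non-trivial kernel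
  set f : LinearMap.range A.mulVecLin →ₗ[ℂ] ℂ :=
    (innerₛₗ ℂ y) ∘ₗ (WithLp.linearEquiv 2 ℂ (Fin d → ℂ)).symm.toLinearMap ∘ₗ
      (LinearMap.range A.mulVecLin).subtype with hf
  have hker : LinearMap.ker f ≠ ⊥ := 
    LinearMap.ker_ne_bot_of_finrank_lt (by rw [Module.finrank_self]; exact hA)
  obtain ⟨⟨z, v, rfl⟩, hz, hz0⟩ := Submodule.exists_mem_ne_zero_of_ne_bot hker
  refine ⟨WithLp.toLp 2 v, ?_, ?_⟩
  · intro h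
    apply hz0
    ext i
    have := congrArg (fun w : EuclideanSpace ℂ (Fin d) => w i) h
    simpa [Matrix.toLpLin_apply] using this
  · simpa [hf, Matrix.toLpLin_apply] using hz

/-- An operator of rank at least two has a refinement one of whose vectors is non-zero and
orthogonal to a prescribed vector. -/
theorem Measurement.exists_isRefinement_orthogonal {d n : ℕ} (E : Measurement d n) {a : Fin n}
    (ha : 1 < (E.op a).rank) (y : EuclideanSpace ℂ (Fin d)) :
    ∃ x : Fin n → Option (Fin d) → EuclideanSpace ℂ (Fin d), E.IsRefinement x ∧
      x a none ≠ 0 ∧ ⟪y, x a none⟫_ℂ = 0 := by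
  obtain ⟨x, hx⟩ := E.exists_isRefinement
  obtain ⟨v, hv, hvy⟩ := exists_apply_ne_zero_inner_eq_zero ha y
  obtain ⟨c, z, hc, hz⟩ := exists_ketbra_add_sum_ketbra (E.posSemidef a) hv
  refine ⟨Function.update (fun a' k => k.elim 0 (x a')) a
    fun k => k.elim (c • Matrix.toEuclideanLin (E.op a) v) z, ?_, ?_, ?_⟩
  · intro a'
    rw [Fintype.sum_option]
    rcases eq_or_ne a' a with rfl | h
    · simpa using hz
    · have h0 : ketbra (0 : EuclideanSpace ℂ (Fin d)) = 0 := by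
        simpa using ketbra_smul 0 (0 : EuclideanSpace ℂ (Fin d))
      simpa [h, h0] using hx a'
  · simpa using ⟨hc, hv⟩
  · simp [hvy]

theorem Measurement.IsRefinement.exists_ne_zero {d n : ℕ} {E : Measurement d n} {ι : Type*}
    [Fintype ι] {x : Fin n → ι → EuclideanSpace ℂ (Fin d)} (hx : E.IsRefinement x) (hd : 0 < d) :
    ∃ a k, x a k ≠ 0 := by
  by_contra! h
  have := hx.sum_norm_sq
  simp only [h, norm_zero] at this
  simp at this
  exact hd.ne (by exact_mod_cast this)

theorem Measurement.dim_pos {d n : ℕ} (E : Measurement d n) (a : Fin n) : 0 < d := by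
  rcases Nat.eq_zero_or_pos d with rfl | h
  · exact absurd (Subsingleton.elim _ _) (E.ne_zero a)
  · exact h

/-- If some operator had rank at least two, it could be refined by a vector orthogonal to one of
the vectors refining the other measurement, against the uniformity of the overlaps. -/
theorem rank_le_one_of_incompatibility_eq {d nE nF : ℕ} {p : ℝ≥0∞} (hp : 1 ≤ p)
    {E : Measurement d nE} {F : Measurement d nF} (h : incompatibility p E F = maxValue p d) :
    (∀ a, (E.op a).rank ≤ 1) ∧ (∀ b, (F.op b).rank ≤ 1) := by
  constructor
  · intro a
    by_contra! ha
    have hd := E.dim_pos a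
    obtain ⟨y, hy⟩ := F.exists_isRefinement
    obtain ⟨b, l, hbl⟩ := hy.exists_ne_zero hd
    obtain ⟨x, hx, hx0, hxy⟩ := E.exists_isRefinement_orthogonal ha (y b l)
    have := (incompatibility_le_and_rigid hd hp hx hy).2 h a none b l
    rw [← inner_conj_symm, hxy] at this
    simp [hx0, hbl] at this
  · intro b
    by_contra! hb
    have hd := F.dim_pos b
    obtain ⟨x, hx⟩ := E.exists_isRefinement
    obtain ⟨a, k, hak⟩ := hx.exists_ne_zero hd
    obtain ⟨y, hy, hy0, hxy⟩ := F.exists_isRefinement_orthogonal hb (x a k)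
    have := (incompatibility_le_and_rigid hd hp hx hy).2 h a k b none
    rw [hxy] at this
    simp [hy0, hak] at this

theorem incompatibility_le_maxValue {d nE nF : ℕ} {p : ℝ≥0∞} (hp : 1 ≤ p)
    (E : Measurement d nE) (F : Measurement d nF) : incompatibility p E F ≤ maxValue p d := by
  rcases Nat.eq_zero_or_pos d with rfl | hd
  · have : IsEmpty (Fin nE) := ⟨fun a => absurd (E.dim_pos a) (lt_irrefl 0)⟩
    simp [incompatibility, maxValue]
  · obtain ⟨x, hx⟩ := E.exists_isRefinement
    obtain ⟨y, hy⟩ := F.exists_isRefinement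
    exact (incompatibility_le_and_rigid hd hp hx hy).1

/-! ### Rank-one measurements -/

theorem exists_eq_smul_ketbra_of_rank_eq_one {d : ℕ} {A : Matrix (Fin d) (Fin d) ℂ}
    (hA : A.PosSemidef) (hr : A.rank = 1) :
    ∃ (α : ℝ) (e : EuclideanSpace ℂ (Fin d)), 0 ≤ α ∧ ‖e‖ = 1 ∧ A = (α : ℂ) • ketbra e := by
  set T := Matrix.toEuclideanLin A with hT
  have hpos : T.IsPositive := Matrix.isPositive_toEuclideanLin_iff.2 hA
  have hr' : Module.finrank ℂ (LinearMap.range T) = 1 := by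
    rw [← hr, Matrix.rank_eq_finrank_range_toLin A (EuclideanSpace.basisFun (Fin d) ℂ).toBasis
      (EuclideanSpace.basisFun (Fin d) ℂ).toBasis, hT, Matrix.toEuclideanLin_eq_toLin_orthonormal]
  obtain ⟨⟨w, hw⟩, hw0, hspan⟩ := finrank_eq_one_iff'.1 hr'
  have hw0' : w ≠ 0 := fun h => hw0 (Subtype.ext h)
  obtain ⟨e, he⟩ : ∃ e : EuclideanSpace ℂ (Fin d), e = ((‖w‖ : ℂ)⁻¹) • w := ⟨_, rfl⟩
  have hwn : (‖w‖ : ℂ) ≠ 0 := by exact_mod_cast norm_ne_zero_iff.2 hw0'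
  have hen : ‖e‖ = 1 := by
    rw [he, norm_smul]
    simp [norm_ne_zero_iff.2 hw0']
  have hee : ⟪e, e⟫_ℂ = 1 := by rw [inner_self_eq_norm_sq_to_K, hen]; simp
  have hTz : ∀ z, T z = ⟪e, T z⟫_ℂ • e := by
    intro z
    obtain ⟨c, hc⟩ := hspan ⟨T z, z, rfl⟩
    have hc' : T z = (c * ‖w‖) • e := by
      rw [he, smul_smul, mul_assoc, mul_inv_cancel₀ hwn, mul_one]
      exact (congrArg Subtype.val hc).symm
    rw [hc', inner_smul_right, hee, mul_one]
  have hα : ⟪e, T e⟫_ℂ = ((⟪e, T e⟫_ℂ).re : ℂ) := by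
    rw [eq_comm, ← Complex.conj_eq_iff_re, inner_conj_symm, hpos.isSymmetric]
  refine ⟨(⟪e, T e⟫_ℂ).re, e, hpos.re_inner_nonneg_right e, hen, ?_⟩
  apply Matrix.toEuclideanLin.injective
  ext z : 1
  have hez : ⟪e, T z⟫_ℂ = ⟪e, T e⟫_ℂ * ⟪e, z⟫_ℂ := by
    rw [← hpos.isSymmetric, hTz e, inner_smul_left, hα, Complex.conj_ofReal]
    simp [hen]
  rw [map_smul, LinearMap.smul_apply, toEuclideanLin_ketbra, ← hα, ← hT, hTz z, hez, smul_smul]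

theorem Measurement.isRankOne_of_rank_le_one {d n : ℕ} (E : Measurement d n)
    (h : ∀ a, (E.op a).rank ≤ 1) : E.IsRankOne := by
  intro a
  refine (h a).antisymm (Nat.one_le_iff_ne_zero.2 fun h0 => E.ne_zero a ?_)
  have hbot := Submodule.finrank_eq_zero.1 h0
  exact (Matrix.ext_of_mulVec_single fun i => by
    simpa using! LinearMap.congr_fun (LinearMap.range_eq_bot.1 hbot) (Pi.single i 1))

theorem Measurement.IsRankOne.exists_isDecomposition {d n : ℕ} {E : Measurement d n}
    (h : E.IsRankOne) : ∃ α e, E.IsDecomposition α e := by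
  choose α e hα using fun a => exists_eq_smul_ketbra_of_rank_eq_one (E.posSemidef a) (h a)
  exact ⟨α, e, hα⟩

theorem Measurement.IsDecomposition.pos {d n : ℕ} {E : Measurement d n} {α : Fin n → ℝ}
    {e : Fin n → EuclideanSpace ℂ (Fin d)} (h : E.IsDecomposition α e) (a : Fin n) : 0 < α a := by
  refine (h a).1.lt_of_ne fun h0 => E.ne_zero a ?_
  rw [(h a).2.2, ← h0]
  simp

theorem Measurement.IsDecomposition.isRefinement {d n : ℕ} {E : Measurement d n} {α : Fin n → ℝ}
    {e : Fin n → EuclideanSpace ℂ (Fin d)} (h : E.IsDecomposition α e) :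
    E.IsRefinement (fun a (_ : Unit) => (√(α a) : ℂ) • e a) := by
  intro a
  rw [Fintype.sum_unique, ketbra_smul, Complex.norm_real, Real.norm_eq_abs, sq_abs,
    Real.sq_sqrt (h a).1, (h a).2.2]

theorem norm_inner_eq_of_incompatibility_eq {d nE nF : ℕ} {p : ℝ≥0∞} (hp : 1 ≤ p)
    {E : Measurement d nE} {F : Measurement d nF} (h : incompatibility p E F = maxValue p d)
    {α : Fin nE → ℝ} {e : Fin nE → EuclideanSpace ℂ (Fin d)} {β : Fin nF → ℝ}
    {f : Fin nF → EuclideanSpace ℂ (Fin d)} (hE : E.IsDecomposition α e)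
    (hF : F.IsDecomposition β f) (a : Fin nE) (b : Fin nF) :
    ‖⟪e a, f b⟫_ℂ‖ = 1 / √(d : ℝ) := by
  have hd := E.dim_pos a
  have hd' : (0 : ℝ) < d := by exact_mod_cast hd
  have key := (incompatibility_le_and_rigid hd hp hE.isRefinement hF.isRefinement).2 h a () b ()
  have hα := hE.pos a
  have hβ := hF.pos b
  simp only [inner_smul_left, inner_smul_right, norm_smul, norm_mul, Complex.conj_ofReal,
    Complex.norm_real, Real.norm_eq_abs, mul_pow, sq_abs, Real.sq_sqrt hα.le, Real.sq_sqrt hβ.le,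
    (hE a).2.1, (hF b).2.1] at key
  have h1 : ‖⟪e a, f b⟫_ℂ‖ ^ 2 = 1 / d := by
    have : α a * β b ≠ 0 := by positivity
    field_simp
    apply mul_left_cancel₀ this
    linarith
  rw [← Real.sqrt_sq (norm_nonneg _), h1, Real.sqrt_div zero_le_one, Real.sqrt_one]

/-! ### Attaining the maximum -/

/-- The `k`-th vector of the Fourier basis of `ℂ^d`. -/
noncomputable def fourierVector (d : ℕ) (k : Fin d) : EuclideanSpace ℂ (Fin d) :=
  WithLp.toLp 2 fun j =>
    Complex.exp (2 * Real.pi * Complex.I / d) ^ ((j : ℕ) * (k : ℕ)) * ((√(d : ℝ))⁻¹ : ℝ)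

theorem norm_sq_fourierVector_apply {d : ℕ} (k j : Fin d) :
    ‖fourierVector d k j‖ ^ 2 = 1 / d := by
  have hd : d ≠ 0 := (Fin.pos k).ne'
  have h1 := Complex.norm_eq_one_of_pow_eq_one (Complex.isPrimitiveRoot_exp d hd).pow_eq_one hd
  simp only [fourierVector, norm_mul, norm_pow, h1, one_pow, one_mul, Complex.norm_real,
    Real.norm_eq_abs, sq_abs, inv_pow, Real.sq_sqrt (Nat.cast_nonneg d), one_div]

theorem norm_fourierVector {d : ℕ} (k : Fin d) : ‖fourierVector d k‖ = 1 := by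
  have hd : (d : ℝ) ≠ 0 := by exact_mod_cast (Fin.pos k).ne'
  rw [EuclideanSpace.norm_eq]
  simp only [norm_sq_fourierVector_apply]
  simp [hd]

theorem sum_ketbra_fourierVector (d : ℕ) : ∑ k, ketbra (fourierVector d k) = 1 := by
  ext i j
  have hd : d ≠ 0 := (Fin.pos i).ne'
  have hdC : (d : ℂ) ≠ 0 := by exact_mod_cast hd
  have hζ := Complex.isPrimitiveRoot_exp d hd
  set ζ := Complex.exp (2 * Real.pi * Complex.I / d) with hζdef
  have hnorm : ‖ζ‖ = 1 := Complex.norm_eq_one_of_pow_eq_one hζ.pow_eq_one hd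
  have hconj : ζ * (starRingEnd ℂ) ζ = 1 := by rw [Complex.mul_conj', hnorm]; simp
  have hentry : ∀ k : Fin d, ketbra (fourierVector d k) i j =
      (ζ ^ (i : ℕ) * (starRingEnd ℂ) ζ ^ (j : ℕ)) ^ (k : ℕ) * (d : ℂ)⁻¹ := by
    intro k
    have hs : (((√(d : ℝ))⁻¹ : ℝ) : ℂ) * (((√(d : ℝ))⁻¹ : ℝ) : ℂ) = (d : ℂ)⁻¹ := by
      rw [← Complex.ofReal_mul, ← mul_inv, Real.mul_self_sqrt (Nat.cast_nonneg d)]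
      simp
    simp only [ketbra, fourierVector, Matrix.vecMulVec_apply, star_mul', RCLike.star_def,
      map_pow, Complex.conj_ofReal, ← hζdef]
    rw [← hs, mul_pow, ← pow_mul, ← pow_mul]
    ring
  rw [Matrix.sum_apply, Finset.sum_congr rfl fun k _ => hentry k, ← Finset.sum_mul,
    Fin.sum_univ_eq_sum_range (fun k => (ζ ^ (i : ℕ) * (starRingEnd ℂ) ζ ^ (j : ℕ)) ^ k) d]
  rcases eq_or_ne i j with rfl | hij
  · rw [← mul_pow, hconj]
    simp [hdC]
  · set η := ζ ^ (i : ℕ) * (starRingEnd ℂ) ζ ^ (j : ℕ) with hη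
    have hη1 : η ≠ 1 := by
      intro h
      apply hij
      have : ζ ^ (i : ℕ) = ζ ^ (j : ℕ) := by
        calc ζ ^ (i : ℕ) = η * ζ ^ (j : ℕ) := by
              rw [hη, mul_assoc, ← mul_pow, mul_comm _ ζ, hconj, one_pow, mul_one]
          _ = ζ ^ (j : ℕ) := by rw [h, one_mul]
      exact Fin.ext (hζ.pow_inj i.2 j.2 this)
    have hηd : η ^ d = 1 := by
      rw [hη, mul_pow, ← pow_mul, ← pow_mul, mul_comm (i : ℕ), mul_comm (j : ℕ), pow_mul, pow_mul,
        ← map_pow, hζ.pow_eq_one]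
      simp
    rw [geom_sum_eq hη1, hηd]
    simp [hij]

theorem posSemidef_ketbra {d : ℕ} (x : EuclideanSpace ℂ (Fin d)) : (ketbra x).PosSemidef :=
  Matrix.posSemidef_vecMulVec_self_star _

theorem ketbra_ne_zero {d : ℕ} {x : EuclideanSpace ℂ (Fin d)} (hx : ‖x‖ = 1) : ketbra x ≠ 0 := by
  intro h
  have h1 := toEuclideanLin_ketbra x x
  rw [h, inner_self_eq_norm_sq_to_K, hx] at h1
  simp at h1
  simp [← h1] at hx

/-- The projective measurement on a family of unit vectors that resolves the identity. -/
noncomputable def Measurement.ofVectors {d n : ℕ} (x : Fin n → EuclideanSpace ℂ (Fin d))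
    (hx : ∀ a, ‖x a‖ = 1) (hsum : ∑ a, ketbra (x a) = 1) : Measurement d n where
  op a := ketbra (x a)
  posSemidef _ := posSemidef_ketbra _
  sum_eq_one := hsum
  ne_zero a := ketbra_ne_zero (hx a)

theorem sum_ketbra_basisFun (d : ℕ) : ∑ k, ketbra (EuclideanSpace.basisFun (Fin d) ℂ k) = 1 := by
  apply Matrix.toEuclideanLin.injective
  ext z : 1
  simp only [map_sum, LinearMap.sum_apply, toEuclideanLin_ketbra]
  rw [OrthonormalBasis.sum_repr']
  simp

/-- The standard basis and the Fourier basis are mutually unbiased. -/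
theorem exists_incompatibility_eq_maxValue {p : ℝ≥0∞} (hp : 1 ≤ p) (d : ℕ) :
    ∃ E F : Measurement d d, incompatibility p E F = maxValue p d := by
  refine ⟨.ofVectors _ (fun _ => by simp) (sum_ketbra_basisFun d),
    .ofVectors _ norm_fourierVector (sum_ketbra_fourierVector d), ?_⟩
  rcases Nat.eq_zero_or_pos d with rfl | hd
  · simp [incompatibility, maxValue]
  have hd' : (0 : ℝ) < d := by exact_mod_cast hd
  have hterm : ∀ a b, schattenNorm p ⁅ketbra (EuclideanSpace.basisFun (Fin d) ℂ a),
      ketbra (fourierVector d b)⁆ = (2 : ℝ) ^ (p⁻¹).toReal * (√((d : ℝ) - 1) / d) := by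
    intro a b
    have h := schattenNorm_smul_commutator hp (c := 1) (by simp)
      (isHermitian_ketbra (EuclideanSpace.basisFun (Fin d) ℂ a)) (fourierVector d b)
    rw [one_smul] at h
    have hin : ‖⟪EuclideanSpace.basisFun (Fin d) ℂ a, fourierVector d b⟫_ℂ‖ ^ 2 = 1 / d := by
      rw [← norm_sq_fourierVector_apply b a]
      simp [EuclideanSpace.inner_single_left]
    rw [h, commutatorSize_ketbra, hin, norm_fourierVector, OrthonormalBasis.norm_eq_one]
    congr 1
    rw [show (1 : ℝ) / d * (1 ^ 2 * 1 ^ 2 - 1 / d) = (d - 1) / (d : ℝ) ^ 2 by field_simp,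
      Real.sqrt_div' _ (by positivity), Real.sqrt_sq hd'.le]
  simp only [incompatibility, Measurement.ofVectors, hterm, maxValue]
  simp
  field_simp

/-! ### The strict triangle inequality in dimension three -/

/-- The size of the commutator for `H = s |0⟩⟨0| + t |1⟩⟨1|`. -/
theorem commutatorSize_two_ketbra (u : OrthonormalBasis (Fin 3) ℂ (EuclideanSpace ℂ (Fin 3)))
    (s t : ℝ) (a b c : ℂ) :
    commutatorSize ((s : ℂ) • ketbra (u 0) + (t : ℂ) • ketbra (u 1))
        (a • u 0 + b • u 1 + c • u 2) =
      √((s ^ 2 * ‖a‖ ^ 2 + t ^ 2 * ‖b‖ ^ 2) * (‖a‖ ^ 2 + ‖b‖ ^ 2 + ‖c‖ ^ 2) -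
        (s * ‖a‖ ^ 2 + t * ‖b‖ ^ 2) ^ 2) := by
  have ho := fun i j => orthonormal_iff_ite.1 u.orthonormal i j
  set ψ := a • u 0 + b • u 1 + c • u 2 with hψ
  have hH : Matrix.toEuclideanLin ((s : ℂ) • ketbra (u 0) + (t : ℂ) • ketbra (u 1)) ψ =
      ((s : ℂ) * a) • u 0 + ((t : ℂ) * b) • u 1 := by
    have hz : ∀ z, Matrix.toEuclideanLin ((s : ℂ) • ketbra (u 0) + (t : ℂ) • ketbra (u 1)) z =
        (s : ℂ) • ⟪u 0, z⟫_ℂ • u 0 + (t : ℂ) • ⟪u 1, z⟫_ℂ • u 1 := fun z => by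
      rw [map_add, map_smul, map_smul, LinearMap.add_apply, LinearMap.smul_apply,
        LinearMap.smul_apply, toEuclideanLin_ketbra, toEuclideanLin_ketbra]
    rw [hz, hψ]
    simp only [inner_add_right, inner_smul_right, ho, smul_smul]
    simp
  have hN : ‖ψ‖ ^ 2 = ‖a‖ ^ 2 + ‖b‖ ^ 2 + ‖c‖ ^ 2 := by
    rw [← u.sum_sq_norm_inner_right]
    simp [Fin.sum_univ_three, hψ, inner_add_right, inner_smul_right, ho]
  have hHN : ‖((s : ℂ) * a) • u 0 + ((t : ℂ) * b) • u 1‖ ^ 2 =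
      s ^ 2 * ‖a‖ ^ 2 + t ^ 2 * ‖b‖ ^ 2 := by
    rw [← u.sum_sq_norm_inner_right]
    simp [Fin.sum_univ_three, inner_add_right, inner_smul_right, ho, mul_pow]
  have hin : ⟪ψ, ((s : ℂ) * a) • u 0 + ((t : ℂ) * b) • u 1⟫_ℂ =
      ((s * ‖a‖ ^ 2 + t * ‖b‖ ^ 2 : ℝ) : ℂ) := by
    push_cast
    rw [← Complex.conj_mul' a, ← Complex.conj_mul' b]
    simp only [hψ, inner_add_left, inner_add_right, inner_smul_left, inner_smul_right, ho]
    simp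
    ring
  rw [commutatorSize, hH, hHN, hN, hin, Complex.ofReal_re]

/-- The components of `P₀ ψ` and `P₁ ψ` orthogonal to `ψ` have negative inner product
`-γ |a|² |b|² / ‖ψ‖²`, so the square of the norm of their sum is less than the sum of the
squares. -/
theorem schattenNorm_add_lt {p : ℝ≥0∞} (hp : 1 ≤ p)
    (u : OrthonormalBasis (Fin 3) ℂ (EuclideanSpace ℂ (Fin 3))) {γ : ℝ} {a b : ℂ} (c : ℂ)
    (hγ : 0 < γ) (hab : a * b ≠ 0) :
    schattenNorm p (Complex.I • ⁅ketbra (u 0), ketbra (a • u 0 + b • u 1 + c • u 2)⁆ +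
        Complex.I • ⁅(γ : ℂ) • ketbra (u 1), ketbra (a • u 0 + b • u 1 + c • u 2)⁆) <
      schattenNorm p (Complex.I • ⁅ketbra (u 0), ketbra (a • u 0 + b • u 1 + c • u 2)⁆) +
        schattenNorm p
          (Complex.I • ⁅(γ : ℂ) • ketbra (u 1), ketbra (a • u 0 + b • u 1 + c • u 2)⁆) := by
  have key : ∀ s t : ℝ, schattenNorm p
      (Complex.I • ⁅(s : ℂ) • ketbra (u 0) + (t : ℂ) • ketbra (u 1),
        ketbra (a • u 0 + b • u 1 + c • u 2)⁆) = _ := fun s t => by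
    have hH : ((s : ℂ) • ketbra (u 0) + (t : ℂ) • ketbra (u 1)).IsHermitian := by
      unfold Matrix.IsHermitian
      rw [Matrix.conjTranspose_add, Matrix.conjTranspose_smul, Matrix.conjTranspose_smul,
        isHermitian_ketbra, isHermitian_ketbra]
      simp
    rw [schattenNorm_smul_commutator hp (by simp) hH, commutatorSize_two_ketbra]
  have hA := key 1 0
  have hB := key 0 γ
  have hAB := key 1 γ
  simp only [Complex.ofReal_one, Complex.ofReal_zero, one_smul, zero_smul, add_zero,
    zero_add] at hA hB hAB
  have hsplit : Complex.I • ⁅ketbra (u 0), ketbra (a • u 0 + b • u 1 + c • u 2)⁆ +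
        Complex.I • ⁅(γ : ℂ) • ketbra (u 1), ketbra (a • u 0 + b • u 1 + c • u 2)⁆ =
      Complex.I • ⁅ketbra (u 0) + (γ : ℂ) • ketbra (u 1),
        ketbra (a • u 0 + b • u 1 + c • u 2)⁆ := by
    rw [← smul_add]
    congr 1
    simp only [Ring.lie_def, add_mul, mul_add]
    abel
  rw [hsplit, hA, hB, hAB, ← mul_add]
  refine mul_lt_mul_of_pos_left ?_ (by positivity)
  have ha : 0 < ‖a‖ ^ 2 := by have := left_ne_zero_of_mul hab; positivity
  have hb : 0 < ‖b‖ ^ 2 := by have := right_ne_zero_of_mul hab; positivity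
  have hc : 0 ≤ ‖c‖ ^ 2 := by positivity
  generalize ‖a‖ ^ 2 = α at *
  generalize ‖b‖ ^ 2 = β at *
  generalize ‖c‖ ^ 2 = δ at *
  set X := (1 ^ 2 * α + 0 ^ 2 * β) * (α + β + δ) - (1 * α + 0 * β) ^ 2 with hX
  set Y := (0 ^ 2 * α + γ ^ 2 * β) * (α + β + δ) - (0 * α + γ * β) ^ 2 with hY
  have hX' : X = α * (β + δ) := by rw [hX]; ring
  have hY' : Y = γ ^ 2 * β * (α + δ) := by rw [hY]; ring
  have hX0 : 0 ≤ X := by rw [hX']; positivity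
  have hY0 : 0 ≤ Y := by rw [hY']; positivity
  have hXY : 0 < √X + √Y := by
    have : 0 < √X := Real.sqrt_pos.2 (by rw [hX']; positivity)
    positivity
  rw [Real.sqrt_lt' hXY]
  have hcross : 0 < γ * α * β := by positivity
  calc _ = X + Y - 2 * (γ * α * β) := by rw [hX, hY]; ring
    _ < X + Y + 2 * (√X * √Y) := by
        have : 0 ≤ √X * √Y := by positivity
        linarith
    _ = (√X + √Y) ^ 2 := by rw [add_sq, Real.sq_sqrt hX0, Real.sq_sqrt hY0]; ring

end QIncompat

open scoped ENNReal in
theorem mainTheorem1 (p : ℝ≥0∞) (hp : 1 ≤ p) :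
    (∀ d : ℕ,
      -- the maximum of the incompatibility measure on `ℂ^d`
      IsGreatest
        {x : ℝ | ∃ (nE nF : ℕ) (E : QIncompat.Measurement d nE) (F : QIncompat.Measurement d nF),
          QIncompat.incompatibility p E F = x}
        (QIncompat.maxValue p d) ∧
      -- a measurement operator of rank larger than one excludes maximality
      (∀ (nE nF : ℕ) (E : QIncompat.Measurement d nE) (F : QIncompat.Measurement d nF),
        ((∃ a, 1 < (E.op a).rank) ∨ (∃ b, 1 < (F.op b).rank)) →
          QIncompat.incompatibility p E F < QIncompat.maxValue p d) ∧
      -- maximal pairs are rank-1 with uniform overlaps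
      (∀ (nE nF : ℕ) (E : QIncompat.Measurement d nE) (F : QIncompat.Measurement d nF),
        QIncompat.incompatibility p E F = QIncompat.maxValue p d →
          E.IsRankOne ∧ F.IsRankOne ∧
          (∃ α e, E.IsDecomposition α e) ∧ (∃ β f, F.IsDecomposition β f) ∧
          ∀ α e β f, E.IsDecomposition α e → F.IsDecomposition β f →
            ∀ a b, ‖inner ℂ (e a) (f b)‖ = 1 / √(d : ℝ))) ∧
    -- the strict triangle inequality on `ℂ^3`
    (∀ (u : OrthonormalBasis (Fin 3) ℂ (EuclideanSpace ℂ (Fin 3))) (γ : ℝ) (a b c : ℂ)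
        (P₀ P₁ Q A B : Matrix (Fin 3) (Fin 3) ℂ),
      0 < γ → γ ≤ 1 → a * b ≠ 0 →
      P₀ = QIncompat.ketbra (u 0) →
      P₁ = (γ : ℂ) • QIncompat.ketbra (u 1) →
      Q = QIncompat.ketbra (a • u 0 + b • u 1 + c • u 2) →
      A = Complex.I • ⁅P₀, Q⁆ →
      B = Complex.I • ⁅P₁, Q⁆ →
      QIncompat.schattenNorm p (A + B) <
        QIncompat.schattenNorm p A + QIncompat.schattenNorm p B) := by
  refine ⟨fun d => ⟨⟨?_, ?_⟩, ?_, ?_⟩, ?_⟩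
  · obtain ⟨E, F, h⟩ := QIncompat.exists_incompatibility_eq_maxValue hp d
    exact ⟨d, d, E, F, h⟩
  · rintro _ ⟨nE, nF, E, F, rfl⟩
    exact QIncompat.incompatibility_le_maxValue hp E F
  · intro nE nF E F hrank
    refine (QIncompat.incompatibility_le_maxValue hp E F).lt_of_ne fun h => ?_
    obtain ⟨hE, hF⟩ := QIncompat.rank_le_one_of_incompatibility_eq hp h
    rcases hrank with ⟨a, ha⟩ | ⟨b, hb⟩
    · exact absurd (hE a) (not_le.2 ha)
    · exact absurd (hF b) (not_le.2 hb)
  · intro nE nF E F h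
    obtain ⟨hE, hF⟩ := QIncompat.rank_le_one_of_incompatibility_eq hp h
    have hE1 := E.isRankOne_of_rank_le_one hE
    have hF1 := F.isRankOne_of_rank_le_one hF
    exact ⟨hE1, hF1, hE1.exists_isDecomposition, hF1.exists_isDecomposition,
      fun α e β f hα hβ a b => QIncompat.norm_inner_eq_of_incompatibility_eq hp h hα hβ a b⟩
  · rintro u γ a b c _ _ _ _ _ hγ - hab rfl rfl rfl rfl rfl
    exact QIncompat.schattenNorm_add_lt hp u c hγ hab
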